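/- Let $k\ge 2$ and let $X$ be a $k$-star, i.e. a compact metric space that is a union $X=I_1\cup\dots\cup I_k$ of $k$ arcs (its edges; each $I_j$ is homeomorphic to $[0,1]$) having a common endpoint $b$ and satisfying $I_i\cap I_j=\{b\}$ for $i\ne j$. Let $f:X\to X$ be a homeomorphism such that every edge $I_j$ contains a wandering point of $f$, i.e. a point $x$ that has a neighbourhood $U$ in $X$ with $f^n(U)\cap U=\emptyset$ for all $n\ge 1$. Let $C(X)$ be the hyperspace of nonempty closed connected subsets of $X$ with the Hausdorff metric, and let $C(f):C(X)\to C(X)$, $K\mapsto f(K)$, be the induced map. Then the polynomial entropy of $C(f)$ satisfies $$h_{\mathrm{pol}}(C(f))=k .$$ Here, for a continuous map $g$ of a compact metric space $(Z,d)$, $$h_{\mathrm{pol}}(g)=\lim_{\varepsilon\to 0^+}\limsup_{n\to\infty}\frac{\log \mathrm{sep}(n,\varepsilon)}{\log n},$$ where $\mathrm{sep}(n,\varepsilon)$ is the largest cardinality of a set $E\subseteq Z$ with $\max_{0\le i\le n-1}d(g^i(x),g^i(y))\ge\varepsilon$ for all distinct $x,y\in E$. -/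

import Mathlib

open Set Filter Topology TopologicalSpace

/-- The dynamic (Bowen) metric `d_n^f (x, y) = max_{0 ≤ i ≤ n - 1} d (f^i x, f^i y)`. -/
noncomputable def dynDist {X : Type*} [MetricSpace X] (f : X → X) (n : ℕ) (x y : X) : ℝ :=
  ⨆ i : Fin n, dist (f^[i] x) (f^[i] y)

/-- A finite set `E` is `(f, n, ε)`-separated if any two different points of `E` are at
`d_n^f`-distance at least `ε`. -/
def IsDynSeparated {X : Type*} [MetricSpace X] (f : X → X) (n : ℕ) (ε : ℝ)
    (E : Finset X) : Prop :=
  ∀ x ∈ E, ∀ y ∈ E, x ≠ y → ε ≤ dynDist f n x y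

/-- The maximal cardinality `sep (n, ε)` of an `(f, n, ε)`-separated set (it would be `⊤` if there
were separated sets of arbitrarily large size). -/
noncomputable def sepCard {X : Type*} [MetricSpace X] (f : X → X) (n : ℕ) (ε : ℝ) : ℕ∞ :=
  ⨆ (E : Finset X) (_ : IsDynSeparated f n ε E), (E.card : ℕ∞)

/-- The polynomial growth rate `limsup_{n → ∞} log (sep (n, ε)) / log n` at scale `ε`. -/
noncomputable def polGrowth {X : Type*} [MetricSpace X] (f : X → X) (ε : ℝ) : EReal :=
  limsup (fun n : ℕ => ENNReal.log (sepCard f n ε : ENNReal) / ((Real.log n : ℝ) : EReal)) atTop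

/-- The polynomial entropy `lim_{ε → 0+} limsup_{n → ∞} log (sep (n, ε)) / log n`, with values in
the extended reals. As the growth rate is antitone in `ε`, the limit exists and is the supremum
over all `ε > 0`; see `tendsto_polGrowth`. -/
noncomputable def polEntropy {X : Type*} [MetricSpace X] (f : X → X) : EReal :=
  ⨆ (ε : ℝ) (_ : 0 < ε), polGrowth f ε

theorem polGrowth_antitone {X : Type*} [MetricSpace X] (f : X → X) : Antitone (polGrowth f) := by
  intro ε₁ ε₂ h
  refine limsup_le_limsup (Eventually.of_forall fun n => ?_)
  refine EReal.div_le_div_right_of_nonneg (by exact_mod_cast Real.log_natCast_nonneg n) ?_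
  refine ENNReal.log_monotone (ENat.toENNReal_mono ?_)
  exact iSup_mono fun E => iSup_mono' fun hE =>
    ⟨fun x hx y hy hxy => h.trans (hE x hx y hy hxy), le_rfl⟩

/-- The polynomial entropy is the limit of the growth rates as `ε → 0+`. -/
theorem tendsto_polGrowth {X : Type*} [MetricSpace X] (f : X → X) :
    Tendsto (polGrowth f) (𝓝[>] 0) (𝓝 (polEntropy f)) := by
  refine tendsto_order.2 ⟨fun a ha => ?_, fun a ha => ?_⟩
  · obtain ⟨ε, hε⟩ := lt_iSup_iff.1 ha
    obtain ⟨hε0, hε⟩ := lt_iSup_iff.1 hε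
    filter_upwards [Ioo_mem_nhdsGT hε0] with δ hδ
    exact hε.trans_le (polGrowth_antitone f hδ.2.le)
  · filter_upwards [self_mem_nhdsWithin] with δ hδ
    exact (le_iSup₂ (f := fun (ε : ℝ) (_ : 0 < ε) => polGrowth f ε) δ hδ).trans_lt ha

/-- The hyperspace `C(X)` of subcontinua: nonempty compact connected subsets of `X`, with the
Hausdorff metric (inherited from `NonemptyCompacts X`). In a compact metric space the compact
subsets are exactly the closed ones. -/
abbrev Subcontinua (X : Type*) [MetricSpace X] : Type _ :=
  {K : NonemptyCompacts X // IsConnected (K : Set X)}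

/-- The induced map `C(f) : C(X) → C(X)`, `K ↦ f(K)`. -/
def Subcontinua.induced {X : Type*} [MetricSpace X] (f : X → X) (hf : Continuous f) :
    Subcontinua X → Subcontinua X :=
  fun K => ⟨K.1.map f hf, by
    rw [NonemptyCompacts.coe_map]; exact K.2.image f hf.continuousOn⟩

/-- A point `x` is wandering for `f` if it has a neighbourhood `U` such that
`f^n(U) ∩ U = ∅` for all `n ≥ 1`. -/
def IsWandering {X : Type*} [TopologicalSpace X] (f : X → X) (x : X) : Prop :=
  ∃ U ∈ 𝓝 x, ∀ n : ℕ, 1 ≤ n → (f^[n] '' U) ∩ U = ∅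

/-- The space `X` is a `k`-star (simple `k`-od) with centre `b` and edges `I 0, …, I (k - 1)`: it
is the union of `k` arcs, each with endpoint `b`, any two of which meet only in `b`. -/
structure IsStar {X : Type*} [TopologicalSpace X] (k : ℕ) (b : X) (I : Fin k → Set X) :
    Prop where
  /-- Each edge is homeomorphic to `[0, 1]` by a homeomorphism that carries `0` to `b`. -/
  arc : ∀ j, ∃ φ : unitInterval ≃ₜ I j, (φ 0 : X) = b
  /-- Different edges have only the centre in common. -/
  inter : ∀ i j, i ≠ j → I i ∩ I j = {b}
  /-- The edges cover the space. -/
  cover : ⋃ j, I j = univ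

/-! ### Growth rates from bounds on separated sets -/

section Growth

variable {Z : Type*} [MetricSpace Z]

/-! Upper bound: let the finite set `P` cut the star into pieces of small diameter, and let `A` be
the union of the preimages of `P` under `f^i`, `i < n`, so that `A` has `O(n)` points. If `K` and
`L` lie in a connected `Z` with `A ∩ Z ⊆ K ∩ L`, then `P ∩ f^i(Z)` lies in both `f^i(K)` and
`f^i(L)`, so these sets stay close up to time `n`. Such a `Z` exists as soon as `K` and `L` have the
same position relative to `A` (`exists_code`). A continuum through the centre has `O(n^k)`
positions, one endpoint per edge. One that misses the centre is a subarc of an edge and has `O(n^2)`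
positions, which is no more because `2 ≤ k`.

Lower bound: for `3 ≤ k` the centre is fixed (`apply_center`) and some `f^N` preserves every edge,
on which it is increasing. Backward orbits of the wandering points are then monotone. The `n^k`
continua that end, on each edge, at one of the first `n` points of the orbit are separated: a
suitable iterate brings one end to the start of the orbit while the other is still at least one step
away (`le_polEntropy_of_backward_orbits`).

For `k = 2` the centre may move, but the space is an arc and `f^2` is increasing. One backward orbit
supplies both endpoints of `n^2` subarcs (`two_le_polEntropy_of_lt`). -/

lemma dist_iterate_le_dynDist (g : Z → Z) {n i : ℕ} (hi : i < n) (x y : Z) :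
    dist (g^[i] x) (g^[i] y) ≤ dynDist g n x y :=
  le_ciSup (f := fun i : Fin n => dist (g^[i] x) (g^[i] y)) (Set.finite_range _).bddAbove ⟨i, hi⟩

lemma dynDist_self (g : Z → Z) (n : ℕ) (x : Z) : dynDist g n x x = 0 := by
  simp [dynDist]

lemma dynDist_le {g : Z → Z} {n : ℕ} {x y : Z} {c : ℝ} (hc : 0 ≤ c)
    (h : ∀ i < n, dist (g^[i] x) (g^[i] y) ≤ c) : dynDist g n x y ≤ c :=
  Real.iSup_le (fun i => h i i.2) hc

lemma sepCard_le_card {D : Type*} [Fintype D] (g : Z → Z) (n : ℕ) (ε : ℝ) (code : Z → D)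
    (h : ∀ x y, code x = code y → dynDist g n x y < ε) : sepCard g n ε ≤ Fintype.card D := by
  refine iSup₂_le fun E hE => ?_
  have hinj : Set.InjOn code E := fun x hx y hy hxy => by
    by_contra hne
    exact absurd (h x y hxy) (not_lt.2 (hE x hx y hy hne))
  exact_mod_cast Finset.card_le_card_of_injOn code (t := Finset.univ) (fun _ _ => by simp) hinj

lemma card_le_sepCard {D : Type*} [Fintype D] (g : Z → Z) (n : ℕ) {ε : ℝ} (hε : 0 < ε)
    (F : D → Z) (h : ∀ x y, x ≠ y → ε ≤ dynDist g n (F x) (F y)) :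
    (Fintype.card D : ℕ∞) ≤ sepCard g n ε := by
  classical
  have hinj : Function.Injective F := fun x y hxy => by
    by_contra hne
    have := h x y hne
    rw [hxy, dynDist_self] at this
    exact absurd this (not_le.2 hε)
  have hsep : IsDynSeparated g n ε (Finset.univ.image F) := by
    intro x hx y hy hxy
    obtain ⟨u, -, rfl⟩ := Finset.mem_image.1 hx
    obtain ⟨v, -, rfl⟩ := Finset.mem_image.1 hy
    exact h u v fun huv => hxy (by rw [huv])
  refine le_trans ?_ (le_iSup₂ (f := fun (E : Finset Z) (_ : IsDynSeparated g n ε E) =>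
    (E.card : ℕ∞)) _ hsep)
  rw [Finset.card_image_of_injective _ hinj, Finset.card_univ]

lemma ENNReal_log_natCast {m : ℕ} (hm : 0 < m) :
    ENNReal.log ((m : ℕ∞) : ENNReal) = ((Real.log m : ℝ) : EReal) := by
  have : ((m : ℕ∞) : ENNReal) = ENNReal.ofReal (m : ℝ) := by simp
  rw [this, ENNReal.log_ofReal_of_pos (by exact_mod_cast hm)]

lemma polGrowth_le_of_sepCard_le (g : Z → Z) (ε : ℝ) {C k : ℕ} (hC : 0 < C)
    (h : ∀ n, 1 ≤ n → sepCard g n ε ≤ ((C * n ^ k : ℕ) : ℕ∞)) :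
    polGrowth g ε ≤ (k : EReal) := by
  have hlim : Tendsto (fun n : ℕ => (((Real.log C + k * Real.log n) / Real.log n : ℝ) : EReal))
      atTop (𝓝 ((k : ℝ) : EReal)) := by
    refine (continuous_coe_real_ereal.tendsto _).comp ?_
    have hlog : Tendsto (fun n : ℕ => Real.log n) atTop atTop :=
      Real.tendsto_log_atTop.comp tendsto_natCast_atTop_atTop
    have h1 : Tendsto (fun n : ℕ => Real.log C / Real.log n + k) atTop (𝓝 (0 + k)) :=
      (hlog.const_div_atTop _).add tendsto_const_nhds
    rw [zero_add] at h1
    refine h1.congr' ?_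
    filter_upwards [hlog.eventually_gt_atTop 0] with n hn
    field_simp
  have hlim' := hlim.limsup_eq
  rw [show ((k : EReal)) = ((k : ℝ) : EReal) by simp, ← hlim']
  refine limsup_le_limsup ?_
  filter_upwards [eventually_ge_atTop 2] with n hn
  have hn0 : 0 < n := by omega
  have hpos : 0 < C * n ^ k := by positivity
  rw [EReal.coe_div]
  refine EReal.div_le_div_right_of_nonneg (by exact_mod_cast Real.log_natCast_nonneg n) ?_
  refine (ENNReal.log_monotone (ENat.toENNReal_mono (h n (by omega)))).trans ?_
  rw [ENNReal_log_natCast hpos]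
  push_cast
  rw [Real.log_mul (by positivity) (by positivity), Real.log_pow]
  push_cast
  exact le_rfl

lemma le_polGrowth_of_le_sepCard (g : Z → Z) (ε : ℝ) {T k : ℕ} (hT : 0 < T)
    (h : ∀ n, 1 ≤ n → ((n ^ k : ℕ) : ℕ∞) ≤ sepCard g (T * n) ε) :
    (k : EReal) ≤ polGrowth g ε := by
  have hlim : Tendsto (fun n : ℕ => ((k * Real.log n / Real.log (T * n : ℕ) : ℝ) : EReal))
      atTop (𝓝 ((k : ℝ) : EReal)) := by
    refine (continuous_coe_real_ereal.tendsto _).comp ?_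
    have hlog : Tendsto (fun n : ℕ => Real.log n) atTop atTop :=
      Real.tendsto_log_atTop.comp tendsto_natCast_atTop_atTop
    have h1 : Tendsto (fun n : ℕ => (k : ℝ) / (Real.log T / Real.log n + 1)) atTop
        (𝓝 (k / (0 + 1))) :=
      tendsto_const_nhds.div ((hlog.const_div_atTop _).add tendsto_const_nhds) (by norm_num)
    rw [zero_add, div_one] at h1
    refine h1.congr' ?_
    filter_upwards [hlog.eventually_gt_atTop 0, eventually_ge_atTop 1] with n hn hn1
    have : (0 : ℝ) ≤ Real.log T := Real.log_natCast_nonneg T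
    push_cast
    rw [Real.log_mul (by positivity) (by positivity)]
    field_simp
  have hsub : Tendsto (fun n : ℕ => T * n) atTop atTop :=
    tendsto_id.const_mul_atTop' hT
  rw [show ((k : EReal)) = ((k : ℝ) : EReal) by simp, ← hlim.limsup_eq]
  -- The limsup along the subsequence of times `T * n` bounds the full limsup from below.
  refine le_trans ?_ (limsup_le_limsup_of_le hsub)
  rw [← limsup_comp]
  refine limsup_le_limsup ?_
  filter_upwards [eventually_ge_atTop 1] with n hn
  rw [EReal.coe_div]
  refine EReal.div_le_div_right_of_nonneg
    (by exact_mod_cast Real.log_natCast_nonneg (T * n)) ?_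
  refine le_trans ?_ (ENNReal.log_monotone (ENat.toENNReal_mono (h n hn)))
  rw [ENNReal_log_natCast (by positivity)]
  push_cast
  rw [Real.log_pow]
  push_cast
  exact le_rfl

end Growth

/-! ### Iterates and distances in the hyperspace -/

section Hyperspace

variable {X : Type*} [MetricSpace X]

lemma Subcontinua.coe_iterate_induced (f : X → X) (hf : Continuous f) (i : ℕ)
    (K : Subcontinua X) :
    ((((Subcontinua.induced f hf)^[i] K).1 : NonemptyCompacts X) : Set X) = f^[i] '' (K.1 : Set X) := by
  induction i with
  | zero => simp
  | succ i ih =>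
    rw [Function.iterate_succ_apply', Function.iterate_succ', image_comp, ← ih]
    exact NonemptyCompacts.coe_map _ _

lemma Subcontinua.dist_eq (K L : Subcontinua X) :
    dist K L = Metric.hausdorffDist (K.1 : Set X) (L.1 : Set X) := by
  exact Subtype.dist_eq _ _

lemma Subcontinua.exists_dist_lt {K L : Subcontinua X} {δ : ℝ} (h : dist K L < δ) {p : X}
    (hp : p ∈ (K.1 : Set X)) : ∃ w ∈ (L.1 : Set X), dist p w < δ := by
  rw [Subcontinua.dist_eq] at h
  exact Metric.exists_dist_lt_of_hausdorffDist_lt hp h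
    (Metric.hausdorffEDist_ne_top_of_nonempty_of_bounded K.1.nonempty L.1.nonempty
      K.1.isCompact.isBounded L.1.isCompact.isBounded)

/-- A uniformly continuous function that separates a point of one continuum from all of another
one bounds their distance from below. -/
lemma Subcontinua.exists_le_dist {Y : Type*} [MetricSpace Y] {q : X → Y}
    (hq : UniformContinuous q) {c : ℝ} (hc : 0 < c) :
    ∃ δ > 0, ∀ K L : Subcontinua X,
      (∃ p ∈ (K.1 : Set X), ∀ w ∈ (L.1 : Set X), c ≤ dist (q p) (q w)) → δ ≤ dist K L := by
  obtain ⟨δ, hδ, h⟩ := Metric.uniformContinuous_iff.1 hq c hc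
  refine ⟨δ, hδ, fun K L ⟨p, hp, hpw⟩ => ?_⟩
  by_contra! hlt
  obtain ⟨w, hw, hd⟩ := Subcontinua.exists_dist_lt hlt hp
  exact absurd (h hd) (not_lt.2 (hpw w hw))

end Hyperspace

/-! ### Coordinates on a star -/

section Chart

variable {X : Type*}

/-- Coordinates on a `k`-star: parametrizations of the edges and the retractions to them. -/
structure StarChart (X : Type*) [TopologicalSpace X] (k : ℕ) (b : X) where
  /-- The parametrization of an edge. -/
  e : Fin k → unitInterval → X
  /-- The retraction to an edge, in its coordinate. -/
  h : Fin k → X → unitInterval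
  continuous_e : ∀ j, Continuous (e j)
  continuous_h : ∀ j, Continuous (h j)
  e_zero : ∀ j, e j 0 = b
  h_e : ∀ j u, h j (e j u) = u
  h_e_of_ne : ∀ i j, i ≠ j → ∀ u, h i (e j u) = 0
  exists_e : ∀ x, ∃ j u, e j u = x

lemma IsStar.exists_chart [MetricSpace X] {k : ℕ} {b : X} {I : Fin k → Set X}
    (hX : IsStar k b I) : ∃ c : StarChart X k b, ∀ j, I j = range (c.e j) := by
  classical
  choose φ hφ using hX.arc
  have hcl : ∀ j, IsClosed (I j) := fun j => by
    have : I j = range (fun u => (φ j u : X)) := by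
      rw [range_comp' Subtype.val (φ j), (φ j).surjective.range_eq]
      simp
    rw [this]
    exact (isCompact_range (by fun_prop)).isClosed
  have hcov : ∀ x, ∃ j, x ∈ I j := fun x => by
    simpa using hX.cover.symm.subset (mem_univ x)
  -- The default `0` is the coordinate of the centre, so `h j` collapses the other edges to `b` and
  -- is continuous by gluing over finitely many closed edges.
  let h : Fin k → X → unitInterval := fun j x =>
    if hx : x ∈ I j then (φ j).symm ⟨x, hx⟩ else 0
  have hne : ∀ i j, i ≠ j → ∀ x ∈ I j, h i x = 0 := by
    intro i j hij x hx
    by_cases hxi : x ∈ I i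
    · have hxb : x = b := by
        have : x ∈ I i ∩ I j := ⟨hxi, hx⟩
        rwa [hX.inter i j hij] at this
      simp only [h, hxi, dif_pos]
      rw [Homeomorph.symm_apply_eq]
      exact Subtype.ext (hxb.trans (hφ i).symm)
    · simp [h, hxi]
  refine ⟨⟨fun j u => φ j u, h, fun j => by fun_prop, fun j => ?_, hφ, fun j u => ?_,
    fun i j hij u => hne i j hij _ (φ j u).2, fun x => ?_⟩, fun j => ?_⟩
  · refine (locallyFinite_of_finite I).continuous hX.cover hcl fun i => ?_
    by_cases hij : j = i
    · subst hij
      rw [continuousOn_iff_continuous_domRestrict]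
      refine (φ j).symm.continuous.congr fun x => ?_
      simp [h]
    · exact continuousOn_const.congr fun x hx => hne j i hij x hx
  · simp [h]
  · obtain ⟨j, hj⟩ := hcov x
    exact ⟨j, (φ j).symm ⟨x, hj⟩, by simp⟩
  · ext x
    refine ⟨fun hx => ⟨(φ j).symm ⟨x, hx⟩, by simp⟩, ?_⟩
    rintro ⟨u, rfl⟩
    exact (φ j u).2

namespace StarChart

variable [MetricSpace X] {k : ℕ} {b : X} (c : StarChart X k b)

/-- Since `h j` vanishes on the other edges, a positive value determines the point. Thus `0 < c.h j
x` serves below to say that `x` is on edge `j` and off the centre. -/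
lemma e_h {j : Fin k} {x : X} (hx : 0 < c.h j x) : c.e j (c.h j x) = x := by
  obtain ⟨i, u, rfl⟩ := c.exists_e x
  by_cases hij : j = i
  · subst hij; rw [c.h_e]
  · rw [c.h_e_of_ne j i hij] at hx
    exact absurd hx (lt_irrefl _)

lemma h_center (j : Fin k) : c.h j b = 0 := by
  have := c.h_e j 0
  rwa [c.e_zero] at this

lemma isPreconnected_image_e (j : Fin k) {s : Set unitInterval} (hs : s.OrdConnected) :
    IsPreconnected (c.e j '' s) :=
  hs.isPreconnected.image _ (c.continuous_e j).continuousOn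

/-- A connected set that meets an open cell of an edge, and contains no endpoint of the cell,
is contained in the cell. -/
lemma subset_image_Ioo {Z : Set X} (hZ : IsPreconnected Z) {j : Fin k} {lo hi u : unitInterval}
    (hu : u ∈ Icc lo hi) (hx : c.e j u ∈ Z) (hlo : c.e j lo ∉ Z) (hhi : c.e j hi ∉ Z) :
    Z ⊆ c.e j '' Ioo lo hi := by
  have hO : c.e j '' Ioo lo hi = c.h j ⁻¹' Ioo lo hi := by
    ext x
    constructor
    · rintro ⟨v, hv, rfl⟩
      rwa [mem_preimage, c.h_e]
    · intro hx
      exact ⟨c.h j x, hx, c.e_h (lt_of_le_of_lt bot_le hx.1)⟩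
  have hV : IsClosed (c.e j '' Icc lo hi) :=
    (isCompact_Icc.image (c.continuous_e j)).isClosed
  refine hZ.subset_left_of_subset_union (u := c.e j '' Ioo lo hi)
    (v := (c.e j '' Icc lo hi)ᶜ) ?_ hV.isOpen_compl ?_ ?_ ?_
  · rw [hO]; exact isOpen_Ioo.preimage (c.continuous_h j)
  · exact disjoint_compl_right.mono_left (image_mono Ioo_subset_Icc_self)
  · intro x hxZ
    by_cases hxI : x ∈ c.e j '' Icc lo hi
    · obtain ⟨v, hv, rfl⟩ := hxI
      refine Or.inl ⟨v, ⟨lt_of_le_of_ne hv.1 ?_, lt_of_le_of_ne hv.2 ?_⟩, rfl⟩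
      · rintro rfl; exact hlo hxZ
      · rintro rfl; exact hhi hxZ
    · exact Or.inr hxI
  · refine ⟨_, hx, u, ⟨lt_of_le_of_ne hu.1 ?_, lt_of_le_of_ne hu.2 ?_⟩, rfl⟩
    · rintro rfl; exact hlo hx
    · rintro rfl; exact hhi hx

/-- A connected set that misses the centre is contained in the interior of an edge. -/
lemma h_pos_of_isPreconnected {Z : Set X} (hZ : IsPreconnected Z) (hb : b ∉ Z) {j : Fin k}
    {x y : X} (hx : x ∈ Z) (hxj : 0 < c.h j x) (hy : y ∈ Z) : 0 < c.h j y := by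
  have hV : IsClosed (range (c.e j)) := (isCompact_range (c.continuous_e j)).isClosed
  have := hZ.subset_left_of_subset_union (u := c.h j ⁻¹' Ioi 0) (v := (range (c.e j))ᶜ)
    (isOpen_Ioi.preimage (c.continuous_h j)) hV.isOpen_compl
    (disjoint_compl_right.mono_left fun z (hz : 0 < c.h j z) =>
      (⟨_, c.e_h hz⟩ : z ∈ range (c.e j))) (fun z hz => ?_) ⟨x, hx, hxj⟩
  · exact this hy
  · by_cases hzj : z ∈ range (c.e j)
    · obtain ⟨v, rfl⟩ := hzj
      refine Or.inl ?_
      rw [mem_preimage, c.h_e, mem_Ioi, unitInterval.pos_iff_ne_zero]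
      rintro rfl
      rw [c.e_zero] at hz
      exact hb hz
    · exact Or.inr hzj

/-- The image of `Z` under `h j` is an interval, and positive coordinates lift back uniquely.
Coordinate `0` occurs only if `s = u = 0`, where `hs` applies. -/
lemma e_mem_of_isPreconnected {Z : Set X} (hZ : IsPreconnected Z) {j : Fin k}
    {s u t : unitInterval} (hs : c.e j s ∈ Z) (ht : c.e j t ∈ Z) (hsu : s ≤ u) (hut : u ≤ t) :
    c.e j u ∈ Z := by
  have hord : (c.h j '' Z).OrdConnected :=
    (hZ.image _ (c.continuous_h j).continuousOn).ordConnected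
  have : u ∈ c.h j '' Z := by
    refine hord.out ⟨_, hs, c.h_e j s⟩ ⟨_, ht, c.h_e j t⟩ ⟨hsu, hut⟩
  obtain ⟨w, hw, rfl⟩ := this
  rcases eq_or_lt_of_le (bot_le : 0 ≤ c.h j w) with h0 | h0
  · rw [← h0] at hsu ⊢
    rwa [le_antisymm hsu bot_le] at hs
  · rwa [c.e_h h0]

end StarChart

end Chart


/-! ### The upper bound -/

section Upper

variable {X : Type*} [MetricSpace X] {k : ℕ} {b : X}

namespace StarChart

/-- A finite set that cuts the star into pieces of small diameter. -/
lemma exists_finset_dist_lt (c : StarChart X k b) {ε : ℝ} (hε : 0 < ε) :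
    ∃ P : Finset X, ∀ Z : Set X, IsPreconnected Z → ∀ x ∈ Z,
      (∃ p ∈ P, p ∈ Z ∧ dist x p < ε) ∨ ∀ y ∈ Z, dist x y < ε := by
  classical
  -- Intersecting over the edges makes one subdivision of the interval serve all of them.
  let U : unitInterval → Set unitInterval :=
    fun v => ⋂ j, {u | dist (c.e j u) (c.e j v) < ε / 2}
  have hU : ∀ v, IsOpen (U v) := fun v =>
    isOpen_iInter_of_finite fun j =>
      isOpen_lt ((c.continuous_e j).dist continuous_const) continuous_const
  have hcov : (univ : Set unitInterval) ⊆ ⋃ v, U v := fun v _ =>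
    mem_iUnion.2 ⟨v, mem_iInter.2 fun j => by simpa using half_pos hε⟩
  obtain ⟨t, ht0, htm, ⟨m, hm⟩, hcell⟩ :=
    exists_monotone_Icc_subset_open_cover_unitInterval hU hcov
  have hsmall : ∀ n j, ∀ u ∈ Icc (t n) (t (n + 1)), ∀ v ∈ Icc (t n) (t (n + 1)),
      dist (c.e j u) (c.e j v) < ε := by
    intro n j u hu v hv
    obtain ⟨w, hw⟩ := hcell n
    have h1 := mem_iInter.1 (hw hu) j
    have h2 := mem_iInter.1 (hw hv) j
    calc _ ≤ _ := dist_triangle_right _ _ (c.e j w)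
      _ < ε / 2 + ε / 2 := add_lt_add h1 h2
      _ = ε := add_halves ε
  have hfind : ∀ u, ∃ n ≤ m, u ∈ Icc (t n) (t (n + 1)) := by
    intro u
    have hex : ∃ n, u ≤ t (n + 1) := ⟨m, by rw [hm _ (Nat.le_succ m)]; exact le_top⟩
    refine ⟨Nat.find hex, Nat.find_min' hex (by rw [hm _ (Nat.le_succ m)]; exact le_top), ?_,
      Nat.find_spec hex⟩
    rcases hn : Nat.find hex with _ | n
    · rw [ht0]; exact bot_le
    · exact (not_le.1 (Nat.find_min hex (m := n) (by omega))).le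
  refine ⟨(Finset.univ ×ˢ Finset.range (m + 2)).image fun q : Fin k × ℕ => c.e q.1 (t q.2),
    fun Z hZ x hx => ?_⟩
  obtain ⟨j, u, rfl⟩ := c.exists_e x
  obtain ⟨n, hn, hu⟩ := hfind u
  have hle : t n ≤ t (n + 1) := htm n.le_succ
  by_cases hlo : c.e j (t n) ∈ Z
  · exact Or.inl ⟨_, Finset.mem_image.2 ⟨(j, n), by simp; omega, rfl⟩, hlo,
      hsmall n j u hu _ ⟨le_rfl, hle⟩⟩
  by_cases hhi : c.e j (t (n + 1)) ∈ Z
  · exact Or.inl ⟨_, Finset.mem_image.2 ⟨(j, n + 1), by simp; omega, rfl⟩, hhi,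
      hsmall n j u hu _ ⟨hle, le_rfl⟩⟩
  refine Or.inr fun y hy => ?_
  obtain ⟨v, hv, rfl⟩ := c.subset_image_Ioo hZ hu hx hlo hhi hy
  exact hsmall n j u hu v (Ioo_subset_Icc_self hv)

end StarChart

/-- Among the traces on a finite set of the sublevel sets of a function, each is determined by its
cardinality. -/
lemma Finset.filter_exists_le_eq_of_card_eq {α β : Type*} [LinearOrder β] (A : Finset α)
    (q : α → β) (S T : Set α) [DecidablePred fun a => ∃ w ∈ S, q a ≤ q w]
    [DecidablePred fun a => ∃ w ∈ T, q a ≤ q w]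
    (h : (A.filter fun a => ∃ w ∈ S, q a ≤ q w).card =
      (A.filter fun a => ∃ w ∈ T, q a ≤ q w).card) :
    (A.filter fun a => ∃ w ∈ S, q a ≤ q w) = A.filter fun a => ∃ w ∈ T, q a ≤ q w := by
  -- Either `T` dominates all of `S`, or some `s` lies above all of `T`. So the traces are nested,
  -- and equal size forces equality.
  by_cases hST : ∀ s ∈ S, ∃ w ∈ T, q s ≤ q w
  · refine Finset.eq_of_subset_of_card_le (Finset.monotone_filter_right A ?_) h.ge
    rintro a _ ⟨s, hs, has⟩
    obtain ⟨w, hw, hsw⟩ := hST s hs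
    exact ⟨w, hw, has.trans hsw⟩
  · push Not at hST
    obtain ⟨s, hs, hsT⟩ := hST
    refine (Finset.eq_of_subset_of_card_le (Finset.monotone_filter_right A ?_) h.le).symm
    rintro a _ ⟨w, hw, haw⟩
    exact ⟨s, hs, haw.trans (hsT w hw).le⟩

namespace StarChart

/-- The subcontinua of a star are classified, up to their position relative to a finite set, by
polynomially many codes. -/
lemma exists_code (c : StarChart X k b) (A : Finset X) :
    ∃ code : Subcontinua X → (Fin k → Fin (A.card + 1)) ⊕
        (Fin k × Fin (A.card + 1) × Fin (A.card + 1)),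
      ∀ K L : Subcontinua X, code K = code L → ∃ Z : Set X, IsPreconnected Z ∧
        (K.1 : Set X) ⊆ Z ∧ (L.1 : Set X) ⊆ Z ∧
        ∀ a ∈ A, a ∈ Z → a ∈ (K.1 : Set X) ∧ a ∈ (L.1 : Set X) := by
  classical
  let dn : Fin k → Set X → Finset X := fun j K => A.filter fun a => ∃ w ∈ K, c.h j a ≤ c.h j w
  let up : Fin k → Set X → Finset X := fun j K => A.filter fun a => ∃ w ∈ K, c.h j w ≤ c.h j a
  have hdn : ∀ j K, (dn j K).card < A.card + 1 := fun j K =>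
    Nat.lt_succ_of_le (Finset.card_filter_le _ _)
  have hup : ∀ j K, (up j K).card < A.card + 1 := fun j K =>
    Nat.lt_succ_of_le (Finset.card_filter_le _ _)
  have hedge : ∀ K : Subcontinua X, b ∉ (K.1 : Set X) →
      ∃ j, ∀ x ∈ (K.1 : Set X), 0 < c.h j x := by
    intro K hb
    obtain ⟨x, hx⟩ := K.1.nonempty
    obtain ⟨j, u, rfl⟩ := c.exists_e x
    refine ⟨j, fun y hy => c.h_pos_of_isPreconnected K.2.isPreconnected hb hx ?_ hy⟩
    rw [c.h_e, unitInterval.pos_iff_ne_zero]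
    rintro rfl
    rw [c.e_zero] at hx
    exact hb hx
  choose ed hed using hedge
  refine ⟨fun K => if hb : b ∈ (K.1 : Set X) then Sum.inl fun j => ⟨_, hdn j K.1⟩ else
    Sum.inr (ed K hb, ⟨_, hdn (ed K hb) K.1⟩, ⟨_, hup (ed K hb) K.1⟩), fun K L hKL => ?_⟩
  by_cases hbK : b ∈ (K.1 : Set X) <;> by_cases hbL : b ∈ (L.1 : Set X)
  · simp only [hbK, hbL, dif_pos, Sum.inl.injEq, funext_iff, Fin.mk.injEq] at hKL
    have key : ∀ M N : Subcontinua X, b ∈ (N.1 : Set X) → (∀ j, dn j M.1 = dn j N.1) →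
        ∀ a ∈ A, a ∈ (M.1 : Set X) → a ∈ (N.1 : Set X) := by
      intro M N hbN h a haA haM
      obtain ⟨j, u, rfl⟩ := c.exists_e a
      have ha : c.e j u ∈ dn j N.1 := by
        rw [← h j]
        exact Finset.mem_filter.2 ⟨haA, _, haM, le_rfl⟩
      obtain ⟨w, hw, huw⟩ := (Finset.mem_filter.1 ha).2
      rw [c.h_e] at huw
      rcases eq_or_lt_of_le (bot_le : 0 ≤ c.h j w) with h0 | h0
      · rw [← h0] at huw
        rwa [le_antisymm huw bot_le, show (⊥ : unitInterval) = 0 from rfl, c.e_zero]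
      · refine c.e_mem_of_isPreconnected N.2.isPreconnected (s := 0) (t := c.h j w) ?_ ?_ bot_le huw
        · rwa [c.e_zero]
        · rwa [c.e_h h0]
    have heq : ∀ j, dn j K.1 = dn j L.1 := fun j =>
      A.filter_exists_le_eq_of_card_eq (c.h j) _ _ (hKL j)
    -- Both continua contain the centre, so their union is connected.
    refine ⟨K.1 ∪ L.1, K.2.isPreconnected.union b hbK hbL L.2.isPreconnected,
      subset_union_left, subset_union_right, fun a haA ha => ?_⟩
    rcases ha with ha | ha
    · exact ⟨ha, key K L hbL heq a haA ha⟩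
    · exact ⟨key L K hbK (fun j => (heq j).symm) a haA ha, ha⟩
  · simp [hbK, hbL] at hKL
  · simp [hbK, hbL] at hKL
  · simp only [hbK, hbL, dif_neg, not_false_eq_true, Sum.inr.injEq, Prod.mk.injEq,
      Fin.mk.injEq] at hKL
    obtain ⟨hj, hd, hu⟩ := hKL
    have hK := hed K hbK
    have hL := hed L hbL
    rw [← hj] at hL hd hu
    generalize ed K hbK = j at hK hL hd hu
    have heqd : dn j K.1 = dn j L.1 := A.filter_exists_le_eq_of_card_eq (c.h j) _ _ hd
    have hequ : up j K.1 = up j L.1 :=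
      A.filter_exists_le_eq_of_card_eq (fun x => OrderDual.toDual (c.h j x)) _ _ hu
    -- Here `Z` is the hull of `K ∪ L` in the common edge. It fills any gap between `K` and `L`;
    -- equality of both traces shows that no point of `A` lies in the gap.
    have hsub : ∀ x ∈ (K.1 ∪ L.1 : Set X), x ∈ c.e j '' {u | (∃ w ∈ (K.1 ∪ L.1 : Set X),
        c.h j w ≤ u) ∧ ∃ w ∈ (K.1 ∪ L.1 : Set X), u ≤ c.h j w} := fun x hx =>
      ⟨c.h j x, ⟨⟨x, hx, le_rfl⟩, x, hx, le_rfl⟩, c.e_h (hx.elim (hK x) (hL x))⟩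
    refine ⟨_, c.isPreconnected_image_e j ⟨?_⟩, fun x hx => hsub x (Or.inl hx),
      fun x hx => hsub x (Or.inr hx), ?_⟩
    · rintro x ⟨⟨w, hw, hwx⟩, -⟩ y ⟨-, w', hw', hyw'⟩ z hz
      exact ⟨⟨w, hw, hwx.trans hz.1⟩, w', hw', hz.2.trans hyw'⟩
    · rintro _ haA ⟨u, ⟨⟨w, hw, hwu⟩, w', hw', huw'⟩, rfl⟩
      have key : ∀ M : Subcontinua X, (∀ x ∈ (M.1 : Set X), 0 < c.h j x) →
          c.e j u ∈ up j M.1 → c.e j u ∈ dn j M.1 → c.e j u ∈ (M.1 : Set X) := by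
        intro M hM h1 h2
        obtain ⟨v, hv, hvu⟩ := (Finset.mem_filter.1 h1).2
        obtain ⟨v', hv', huv'⟩ := (Finset.mem_filter.1 h2).2
        rw [c.h_e] at hvu huv'
        refine c.e_mem_of_isPreconnected M.2.isPreconnected ?_ ?_ hvu huv'
        · rwa [c.e_h (hM v hv)]
        · rwa [c.e_h (hM v' hv')]
      have h1 : c.e j u ∈ up j K.1 := by
        rcases hw with hw | hw
        · exact Finset.mem_filter.2 ⟨haA, w, hw, by rwa [c.h_e]⟩
        · rw [hequ]; exact Finset.mem_filter.2 ⟨haA, w, hw, by rwa [c.h_e]⟩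
      have h2 : c.e j u ∈ dn j K.1 := by
        rcases hw' with hw' | hw'
        · exact Finset.mem_filter.2 ⟨haA, w', hw', by rwa [c.h_e]⟩
        · rw [heqd]; exact Finset.mem_filter.2 ⟨haA, w', hw', by rwa [c.h_e]⟩
      exact ⟨key K hK h1 h2, key L hL (hequ ▸ h1) (heqd ▸ h2)⟩

lemma sepCard_induced_le (c : StarChart X k b) (hk : 2 ≤ k) (f : X ≃ₜ X) {ε : ℝ} (hε : 0 < ε) :
    ∃ C : ℕ, 0 < C ∧ ∀ n, 1 ≤ n →
      sepCard (Subcontinua.induced f f.continuous) n ε ≤ ((C * n ^ k : ℕ) : ℕ∞) := by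
  classical
  obtain ⟨P, hP⟩ := c.exists_finset_dist_lt (half_pos hε)
  refine ⟨(k + 1) * (P.card + 1) ^ k, by positivity, fun n hn => ?_⟩
  -- A point `z` lies in `A` whenever `f^[i] z ∈ P` for some `i < n`.
  let A : Finset X := (Finset.range n).biUnion fun i => P.image (f.symm^[i])
  have hinv : ∀ i, Function.LeftInverse (f.symm^[i]) (f^[i]) := fun i =>
    Function.LeftInverse.iterate f.symm_apply_apply i
  have hA : A.card ≤ n * P.card :=
    (Finset.card_biUnion_le_card_mul _ _ P.card fun i _ => Finset.card_image_le).trans (by simp)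
  have hA' : A.card + 1 ≤ (P.card + 1) * n := by nlinarith
  obtain ⟨code, hcode⟩ := c.exists_code A
  refine (sepCard_le_card _ n ε code fun K L hKL => ?_).trans ?_
  · obtain ⟨Z, hZ, hKZ, hLZ, hZA⟩ := hcode K L hKL
    refine (dynDist_le (half_pos hε).le fun i hi => ?_).trans_lt (half_lt_self hε)
    have hfZ : IsPreconnected (f^[i] '' Z) :=
      hZ.image _ (f.continuous.iterate i).continuousOn
    have key : ∀ M N : Subcontinua X, (M.1 : Set X) ⊆ Z → (N.1 : Set X) ⊆ Z →
        (∀ a ∈ A, a ∈ Z → a ∈ (N.1 : Set X)) →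
        ∀ x ∈ f^[i] '' (M.1 : Set X), ∃ y ∈ f^[i] '' (N.1 : Set X), dist x y ≤ ε / 2 := by
      intro M N hM hN hNA x hx
      rcases hP _ hfZ x (image_mono hM hx) with ⟨p, hpP, ⟨z, hz, rfl⟩, hd⟩ | h
      · refine ⟨_, ⟨z, hNA z ?_ hz, rfl⟩, hd.le⟩
        exact Finset.mem_biUnion.2 ⟨i, Finset.mem_range.2 hi,
          Finset.mem_image.2 ⟨_, hpP, hinv i z⟩⟩
      · obtain ⟨y, hy⟩ := N.1.nonempty.image (f^[i])
        exact ⟨y, hy, (h y (image_mono hN hy)).le⟩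
    rw [Subcontinua.dist_eq, Subcontinua.coe_iterate_induced, Subcontinua.coe_iterate_induced]
    exact Metric.hausdorffDist_le_of_mem_dist (half_pos hε).le
      (key K L hKZ hLZ fun a ha haZ => (hZA a ha haZ).2)
      (key L K hLZ hKZ fun a ha haZ => (hZA a ha haZ).1)
  · simp only [Fintype.card_sum, Fintype.card_fun, Fintype.card_prod, Fintype.card_fin]
    norm_cast
    calc (A.card + 1) ^ k + k * ((A.card + 1) * (A.card + 1))
        ≤ (A.card + 1) ^ k + k * (A.card + 1) ^ k := by
          -- The subarcs off the centre contribute a square, absorbed because `2 ≤ k`.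
          rw [← sq]
          gcongr
          omega
      _ = (k + 1) * (A.card + 1) ^ k := by ring
      _ ≤ (k + 1) * ((P.card + 1) * n) ^ k := by gcongr
      _ = _ := by rw [mul_pow, mul_assoc]

lemma polEntropy_induced_le (c : StarChart X k b) (hk : 2 ≤ k) (f : X ≃ₜ X) :
    polEntropy (Subcontinua.induced f f.continuous) ≤ (k : EReal) :=
  iSup₂_le fun ε hε => by
    obtain ⟨C, hC, h⟩ := c.sepCard_induced_le hk f hε
    exact polGrowth_le_of_sepCard_le _ ε hC h

end StarChart

end Upper


/-! ### Monotone backward orbits -/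

section Orbits

/-- A strictly increasing map of a linear order reflects `<`, so the first comparison propagates
backwards. -/
lemma StrictMono.strictAnti_backward_orbit {β : Type*} [LinearOrder β] {G : β → β}
    (hG : StrictMono G) {y : ℕ → β} (hy : ∀ m, G (y (m + 1)) = y m) (h : y 1 < y 0) :
    StrictAnti y := by
  refine strictAnti_nat_of_succ_lt fun m => ?_
  induction m with
  | zero => exact h
  | succ m ih => rwa [← hG.lt_iff_lt, hy, hy]

lemma StrictMono.strictMono_backward_orbit {β : Type*} [LinearOrder β] {G : β → β}
    (hG : StrictMono G) {y : ℕ → β} (hy : ∀ m, G (y (m + 1)) = y m) (h : y 0 < y 1) :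
    StrictMono y := by
  refine strictMono_nat_of_lt_succ fun m => ?_
  induction m with
  | zero => exact h
  | succ m ih => rwa [← hG.lt_iff_lt, hy, hy]

lemma iterate_backward_orbit {β : Type*} {G : β → β} {y : ℕ → β}
    (hy : ∀ m, G (y (m + 1)) = y m) (i m : ℕ) : G^[i] (y (m + i)) = y m := by
  induction i with
  | zero => rfl
  | succ i ih => rw [Function.iterate_succ_apply, ← add_assoc, hy, ih]

lemma iterate_backward_orbit_self {β : Type*} {G : β → β} {y : ℕ → β}
    (hy : ∀ m, G (y (m + 1)) = y m) (i : ℕ) : G^[i] (y i) = y 0 := by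
  simpa using iterate_backward_orbit hy i 0

lemma unitInterval.dist_le_dist_of_le {r s t u : unitInterval} (hrs : r ≤ s) (hst : s ≤ t)
    (htu : t ≤ u) : dist s t ≤ dist r u := by
  have h1 : (r : ℝ) ≤ s := hrs
  have h2 : (s : ℝ) ≤ t := hst
  have h3 : (t : ℝ) ≤ u := htu
  rw [Subtype.dist_eq, Subtype.dist_eq, Real.dist_eq, Real.dist_eq, abs_of_nonpos (by linarith),
    abs_of_nonpos (by linarith)]
  linarith

lemma dynDist_comm {Z : Type*} [MetricSpace Z] (g : Z → Z) (n : ℕ) (x y : Z) :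
    dynDist g n x y = dynDist g n y x := by
  simp only [dynDist, dist_comm]

end Orbits

/-! ### The lower bound when the centre is fixed -/

section Lower

variable {X : Type*} [MetricSpace X]

/-- Time `i` of `f^N` is time `N * i` of `f`; only the underlying sets of the iterated continua
matter. -/
lemma Subcontinua.le_dynDist_induced {f : X → X} (hf : Continuous f) {N i n : ℕ} (hi : N * i < n)
    {δ : ℝ} {K L : Subcontinua X}
    (h : ∀ K' L' : Subcontinua X, (K'.1 : Set X) = (f^[N])^[i] '' (K.1 : Set X) →
      (L'.1 : Set X) = (f^[N])^[i] '' (L.1 : Set X) → δ ≤ dist K' L') :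
    δ ≤ dynDist (Subcontinua.induced f hf) n K L := by
  refine (h _ _ ?_ ?_).trans (dist_iterate_le_dynDist _ hi K L) <;>
    rw [Subcontinua.coe_iterate_induced, Function.iterate_mul]

lemma le_polEntropy_of_separated {f : X → X} (hf : Continuous f) {k T : ℕ} (hT : 0 < T)
    {δ : ℝ} (hδ : 0 < δ)
    (F : ∀ n : ℕ, (Fin k → Fin n) → Subcontinua X)
    (hF : ∀ n s t, s ≠ t → δ ≤ dynDist (Subcontinua.induced f hf) (T * n) (F n s) (F n t)) :
    (k : EReal) ≤ polEntropy (Subcontinua.induced f hf) := by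
  refine le_trans ?_ (le_iSup₂ (f := fun (ε : ℝ) (_ : 0 < ε) =>
    polGrowth (Subcontinua.induced f hf) ε) δ hδ)
  refine le_polGrowth_of_le_sepCard _ δ hT fun n _ => ?_
  refine le_trans ?_ (card_le_sepCard _ _ hδ (F n) (hF n))
  simp

lemma IsWandering.iterate_ne {f : X → X} {x : X} (hx : IsWandering f x) {n : ℕ} (hn : 1 ≤ n) :
    f^[n] x ≠ x := by
  obtain ⟨U, hU, h⟩ := hx
  intro he
  have : x ∈ f^[n] '' U ∩ U := ⟨⟨x, mem_of_mem_nhds hU, he⟩, mem_of_mem_nhds hU⟩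
  rwa [h n hn] at this

namespace StarChart

variable {k : ℕ} {b : X} (c : StarChart X k b)

/-- The subcontinuum that contains an initial segment of each edge. -/
def initial [NeZero k] (y : Fin k → unitInterval) : Subcontinua X :=
  ⟨⟨⟨⋃ j, c.e j '' Icc 0 (y j), isCompact_iUnion fun j =>
      isCompact_Icc.image (c.continuous_e j)⟩,
    ⟨b, mem_iUnion.2 ⟨0, 0, ⟨le_rfl, bot_le⟩, c.e_zero 0⟩⟩⟩,
    ⟨b, mem_iUnion.2 ⟨0, 0, ⟨le_rfl, bot_le⟩, c.e_zero 0⟩⟩,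
    isPreconnected_of_forall b fun x hx => by
      obtain ⟨j, hj⟩ := mem_iUnion.1 hx
      exact ⟨_, subset_iUnion (fun j => c.e j '' Icc 0 (y j)) j,
        ⟨0, ⟨le_rfl, bot_le⟩, c.e_zero j⟩, hj, c.isPreconnected_image_e j ordConnected_Icc⟩⟩

lemma mem_initial [NeZero k] {y : Fin k → unitInterval} {x : X} :
    x ∈ ((c.initial y).1 : Set X) ↔ ∀ j, c.h j x ≤ y j := by
  change x ∈ ⋃ j, c.e j '' Icc 0 (y j) ↔ _
  rw [mem_iUnion]
  constructor
  · rintro ⟨i, u, hu, rfl⟩ j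
    by_cases hij : j = i
    · subst hij; rw [c.h_e]; exact hu.2
    · rw [c.h_e_of_ne j i hij]; exact bot_le
  · intro h
    obtain ⟨j, u, rfl⟩ := c.exists_e x
    exact ⟨j, u, ⟨bot_le, by simpa [c.h_e] using h j⟩, rfl⟩

/-- If the iterate `f^N` fixes the centre and preserves the edges, and each edge contains a backward
orbit of `f^N`, then the initial segments up to points of these orbits are separated. -/
lemma le_polEntropy_of_backward_orbits [CompactSpace X] (c : StarChart X k b) (hk : 1 ≤ k)
    {f : X → X} (hf : Continuous f) {N : ℕ} (hN : 0 < N) (hinj : Function.Injective f^[N])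
    (hb : f^[N] b = b) (hedge : ∀ j x, 0 < c.h j x → 0 < c.h j (f^[N] x))
    (p : Fin k → ℕ → X) (hp : ∀ j m, f^[N] (p j (m + 1)) = p j m)
    (hpos : ∀ j m, 0 < c.h j (p j m)) (hne : ∀ j, p j 1 ≠ p j 0) :
    (k : EReal) ≤ polEntropy (Subcontinua.induced f hf) := by
  have : NeZero k := ⟨by omega⟩
  set g := f^[N] with hg
  have hgc : Continuous g := hf.iterate N
  let G : Fin k → unitInterval → unitInterval := fun j u => c.h j (g (c.e j u))
  have hG0 : ∀ j, G j 0 = 0 := fun j => by simp only [G]; rw [c.e_zero, hb, c.h_center]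
  have hGpos : ∀ j u, 0 < u → 0 < G j u := fun j u hu =>
    hedge j _ (by rwa [c.h_e])
  -- The retraction to edge `j` semiconjugates `g` to `G j`: the other edges stay at coordinate `0`.
  have hgG : ∀ j x, c.h j (g x) = G j (c.h j x) := by
    intro j x
    obtain ⟨i, u, rfl⟩ := c.exists_e x
    by_cases hij : j = i
    · subst hij; rw [c.h_e]
    · rw [c.h_e_of_ne j i hij, hG0]
      rcases eq_or_lt_of_le (unitInterval.nonneg' : 0 ≤ u) with h0 | h0
      · rw [← h0, c.e_zero, hb, c.h_center]
      · rw [← c.e_h (hGpos i u h0), c.h_e_of_ne j i hij]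
  have hGinj : ∀ j, Function.Injective (G j) := by
    intro j u v huv
    rcases eq_or_lt_of_le (unitInterval.nonneg' : 0 ≤ u) with hu | hu <;>
      rcases eq_or_lt_of_le (unitInterval.nonneg' : 0 ≤ v) with hv | hv
    · rw [← hu, ← hv]
    · have := hGpos j v hv
      rw [← huv, ← hu, hG0] at this
      exact absurd this (lt_irrefl _)
    · have := hGpos j u hu
      rw [huv, ← hv, hG0] at this
      exact absurd this (lt_irrefl _)
    · have h1 := c.e_h (hGpos j u hu)
      have h2 := c.e_h (hGpos j v hv)
      have h3 : g (c.e j u) = g (c.e j v) := by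
        rw [← h1, ← h2]; exact congrArg _ huv
      rw [← c.h_e j u, hinj h3, c.h_e]
  have hGmono : ∀ j, StrictMono (G j) := by
    intro j
    have hGc : Continuous (G j) := (c.continuous_h j).comp (hgc.comp (c.continuous_e j))
    -- An injective continuous map of the interval is monotone, and fixing `0` excludes the
    -- decreasing case.
    refine (hGc.strictMono_of_inj (hGinj j)).resolve_right fun hanti => ?_
    have := hanti (show (0 : unitInterval) < 1 from zero_lt_one)
    rw [hG0] at this
    exact absurd this not_lt_bot
  let y : Fin k → ℕ → unitInterval := fun j m => c.h j (p j m)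
  have hy : ∀ j m, G j (y j (m + 1)) = y j m := fun j m => by
    simp only [y]; rw [← hgG, hp]
  have hey : ∀ j m, c.e j (y j m) = p j m := fun j m => c.e_h (hpos j m)
  have hyne : ∀ j, y j 1 ≠ y j 0 := fun j h => hne j (by rw [← hey, ← hey, h])
  have hgGi : ∀ i j x, c.h j (g^[i] x) = (G j)^[i] (c.h j x) := fun i j x =>
    (Function.Semiconj.iterate_right (f := c.h j) (ga := g) (gb := G j) (fun x => hgG j x) i) x
  have hδ : ∀ j, ∃ δ > 0, ∀ K L : Subcontinua X, (∃ q ∈ (K.1 : Set X), ∀ w ∈ (L.1 : Set X),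
      dist (y j 1) (y j 0) ≤ dist (c.h j q) (c.h j w)) → δ ≤ dist K L := fun j =>
    Subcontinua.exists_le_dist
      (CompactSpace.uniformContinuous_of_continuous (c.continuous_h j)) (dist_pos.2 (hyne j))
  choose δ hδ0 hδ using hδ
  obtain ⟨j₀, hj₀⟩ := Finite.exists_min δ
  refine le_polEntropy_of_separated hf hN (hδ0 j₀)
    (fun n s => c.initial fun j => y j (s j)) fun n => ?_
  have hmem : ∀ (s : Fin k → ℕ) j, p j (s j) ∈ ((c.initial fun j => y j (s j)).1 : Set X) := by
    intro s j
    rw [c.mem_initial]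
    intro i
    by_cases hij : i = j
    · subst hij; exact le_rfl
    · rw [← hey j, c.h_e_of_ne i j hij]; exact bot_le
  have key : ∀ s t : Fin k → Fin n, ∀ j, s j < t j → δ j₀ ≤
      dynDist (Subcontinua.induced f hf) (N * n) (c.initial fun j => y j (s j))
        (c.initial fun j => y j (t j)) := by
    intro s t j hst
    refine (hj₀ j).trans (Subcontinua.le_dynDist_induced hf (N := N) (i := s j)
      (Nat.mul_lt_mul_of_pos_left (s j).2 hN) fun K L hK hL => ?_)
    obtain ⟨r, hr⟩ : ∃ r : ℕ, (t j : ℕ) = (r + 1) + s j :=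
      ⟨t j - s j - 1, by have : (s j : ℕ) < t j := hst; omega⟩
    have hKle : ∀ w ∈ (K.1 : Set X), c.h j w ≤ y j 0 := by
      intro w hw
      rw [hK] at hw
      obtain ⟨v, hv, rfl⟩ := hw
      have := (hGmono j).monotone.iterate (s j) (c.mem_initial.1 hv j)
      rwa [← hgGi, iterate_backward_orbit_self (hy j)] at this
    have hLle : ∀ w ∈ (L.1 : Set X), c.h j w ≤ y j (r + 1) := by
      intro w hw
      rw [hL] at hw
      obtain ⟨v, hv, rfl⟩ := hw
      have := (hGmono j).monotone.iterate (s j) (c.mem_initial.1 hv j)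
      rwa [← hgGi, hr, iterate_backward_orbit (hy j)] at this
    have hpK : p j 0 ∈ (K.1 : Set X) := by
      rw [hK]
      exact ⟨_, hmem (fun j => s j) j, iterate_backward_orbit_self (hp j) _⟩
    have hpL : p j (r + 1) ∈ (L.1 : Set X) := by
      rw [hL]
      refine ⟨_, hmem (fun j => t j) j, ?_⟩
      rw [hr]
      exact iterate_backward_orbit (hp j) _ _
    -- The ends are now `y j 0` for `K` and `y j (r + 1)` for `L`, with `y j 1` between them or
    -- equal to the latter. The longer continuum has the separating point: `K` if the orbit moves
    -- towards the centre, `L` otherwise.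
    rcases lt_or_gt_of_ne (hyne j) with hlt | hlt
    · refine hδ j K L ⟨_, hpK, fun w hw => ?_⟩
      have h1 : y j (r + 1) ≤ y j 1 :=
        ((hGmono j).strictAnti_backward_orbit (hy j) hlt).antitone (by omega)
      have h2 : c.h j w ≤ y j 1 := (hLle w hw).trans h1
      rw [dist_comm (c.h j (p j 0)) (c.h j w)]
      exact unitInterval.dist_le_dist_of_le h2 hlt.le le_rfl
    · rw [dist_comm]
      refine hδ j L K ⟨_, hpL, fun w hw => ?_⟩
      have h1 : y j 1 ≤ y j (r + 1) :=
        ((hGmono j).strictMono_backward_orbit (hy j) hlt).monotone (by omega)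
      rw [dist_comm (y j 1), dist_comm (c.h j (p j (r + 1))) (c.h j w)]
      exact unitInterval.dist_le_dist_of_le (hKle w hw) hlt.le h1
  intro s t hst
  obtain ⟨j, hj⟩ := Function.ne_iff.1 hst
  rcases lt_or_gt_of_ne hj with h | h
  · exact key s t j h
  · have := key t s j h
    rwa [dynDist_comm] at this

end StarChart

end Lower


/-! ### Fixing the centre, and the case of an arc -/

section Cases

variable {X : Type*} [MetricSpace X]

namespace StarChart

variable {k : ℕ} {b : X}

lemma exists_h_pos (c : StarChart X k b) {x : X} (hx : x ≠ b) : ∃ j, 0 < c.h j x := by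
  obtain ⟨j, u, rfl⟩ := c.exists_e x
  refine ⟨j, ?_⟩
  rw [c.h_e, unitInterval.pos_iff_ne_zero]
  rintro rfl
  exact hx (c.e_zero j)

lemma eq_of_h_pos (c : StarChart X k b) {i j : Fin k} {x : X} (hi : 0 < c.h i x)
    (hj : 0 < c.h j x) : i = j := by
  by_contra hij
  rw [← c.e_h hj, c.h_e_of_ne i j hij] at hi
  exact lt_irrefl _ hi

lemma ne_center_of_h_pos (c : StarChart X k b) {j : Fin k} {x : X} (hj : 0 < c.h j x) : x ≠ b := by
  rintro rfl
  rw [c.h_center] at hj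
  exact lt_irrefl _ hj

lemma isPreconnected_h_gt (c : StarChart X k b) (j : Fin k) (u : unitInterval) :
    IsPreconnected {x | u < c.h j x} := by
  have : {x | u < c.h j x} = c.e j '' Ioi u := by
    ext x
    constructor
    · exact fun hx => ⟨_, hx, c.e_h (lt_of_le_of_lt unitInterval.nonneg' hx)⟩
    · rintro ⟨v, hv, rfl⟩
      rwa [mem_ofPred_eq, c.h_e]
  rw [this]
  exact c.isPreconnected_image_e j ordConnected_Ioi

lemma isPreconnected_h_lt (c : StarChart X k b) (j : Fin k) (u : unitInterval) :
    IsPreconnected {x | c.h j x < u} := by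
  refine isPreconnected_of_forall b fun y hy => ?_
  obtain ⟨i, v, rfl⟩ := c.exists_e y
  refine ⟨c.e i '' Icc 0 v, ?_, ⟨0, ⟨le_rfl, unitInterval.nonneg'⟩, c.e_zero i⟩,
    ⟨v, ⟨unitInterval.nonneg', le_rfl⟩, rfl⟩, c.isPreconnected_image_e i ordConnected_Icc⟩
  rintro _ ⟨t, ht, rfl⟩
  rw [mem_ofPred_eq] at hy ⊢
  by_cases hij : j = i
  · subst hij
    rw [c.h_e] at hy ⊢
    exact ht.2.trans_lt hy
  · rw [c.h_e_of_ne j i hij] at hy ⊢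
    exact hy

/-- A homeomorphism maps no two edges into the same connected set that misses the image of the
centre. -/
lemma eq_of_isPreconnected_image (c : StarChart X k b) (f : X ≃ₜ X) {C : Set X}
    (hC : IsPreconnected C) (hb : f b ∉ C) {i j : Fin k} (hi : f (c.e i 1) ∈ C)
    (hj : f (c.e j 1) ∈ C) : i = j := by
  -- The preimage of `C` is connected and misses the centre, so it stays in a single edge.
  have h1 : IsPreconnected (f.symm '' C) := hC.image _ f.symm.continuous.continuousOn
  have hmem : ∀ x, f x ∈ C → x ∈ f.symm '' C := fun x hx => ⟨_, hx, f.symm_apply_apply x⟩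
  have h2 : b ∉ f.symm '' C := by
    rintro ⟨z, hz, rfl⟩
    rw [f.apply_symm_apply] at hb
    exact hb hz
  have hpos : ∀ l, 0 < c.h l (c.e l 1) := fun l => by rw [c.h_e]; exact zero_lt_one
  exact c.eq_of_h_pos (c.h_pos_of_isPreconnected h1 h2 (hmem _ hi) (hpos i) (hmem _ hj)) (hpos j)

/-- A homeomorphism of a star with at least three edges fixes the centre. -/
lemma apply_center (c : StarChart X k b) (hk : 3 ≤ k) (f : X ≃ₜ X) : f b = b := by
  classical
  by_contra hb
  obtain ⟨j, hj⟩ := c.exists_h_pos hb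
  set u := c.h j (f b) with hu
  have hne : ∀ i, f (c.e i 1) ≠ f b := fun i h => by
    have h0 := c.h_e i 1
    rw [f.injective h, c.h_center] at h0
    exact zero_ne_one h0
  have hside : ∀ i, ¬ c.h j (f (c.e i 1)) < u → u < c.h j (f (c.e i 1)) := by
    intro i hi
    refine lt_of_le_of_ne (not_lt.1 hi) fun h => hne i ?_
    rw [← c.e_h (x := f (c.e i 1)) (j := j) (h ▸ hj), ← h, hu, c.e_h hj]
  -- Removing `f b` leaves two connected sides, given by coordinate `j` below or above `u`; of three
  -- edge ends, two land on the same side.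
  obtain ⟨i, i', hii, heq⟩ := Fintype.exists_ne_map_eq_of_card_lt
    (fun i => decide (c.h j (f (c.e i 1)) < u)) (by simp; omega)
  rw [decide_eq_decide] at heq
  by_cases hi : c.h j (f (c.e i 1)) < u
  · exact hii (c.eq_of_isPreconnected_image f (c.isPreconnected_h_lt j u) (lt_irrefl u) hi
      (heq.1 hi))
  · exact hii (c.eq_of_isPreconnected_image f (c.isPreconnected_h_gt j u) (lt_irrefl u)
      (hside i hi) (hside i' fun h => hi (heq.2 h)))

/-- A power of a homeomorphism that fixes the centre preserves the edges. -/
lemma exists_iterate_preserves_edges (c : StarChart X k b) (f : X ≃ₜ X) (hb : f b = b) :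
    ∃ N > 0, ∀ j x, 0 < c.h j x → 0 < c.h j (f^[N] x) := by
  have hpos : ∀ l, 0 < c.h l (c.e l 1) := fun l => by rw [c.h_e]; exact zero_lt_one
  have hσ : ∀ i, ∃ j, ∀ x, 0 < c.h i x → 0 < c.h j (f x) := by
    intro i
    obtain ⟨j, hj⟩ := c.exists_h_pos (x := f (c.e i 1)) fun h =>
      c.ne_center_of_h_pos (hpos i) (f.injective (h.trans hb.symm))
    refine ⟨j, fun x hx => c.h_pos_of_isPreconnected
      ((c.isPreconnected_h_gt i 0).image f f.continuous.continuousOn) ?_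
      ⟨_, hpos i, rfl⟩ hj ⟨x, hx, rfl⟩⟩
    rintro ⟨z, hz, hzb⟩
    exact c.ne_center_of_h_pos hz (f.injective (hzb.trans hb.symm))
  choose σ hσ using hσ
  have hinj : Function.Injective σ := fun i j hij =>
    c.eq_of_isPreconnected_image f (c.isPreconnected_h_gt (σ i) 0)
      (fun h => c.ne_center_of_h_pos h hb) (hσ i _ (hpos i)) (by rw [hij]; exact hσ j _ (hpos j))
  have hiter : ∀ m i x, 0 < c.h i x → 0 < c.h (σ^[m] i) (f^[m] x) := by
    intro m
    induction m with
    | zero => exact fun i x hx => hx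
    | succ m ih =>
      intro i x hx
      rw [Function.iterate_succ_apply, Function.iterate_succ_apply]
      exact ih _ _ (hσ i x hx)
  -- The map permutes the edges, so the order of this permutation serves as `N`.
  let τ : Equiv.Perm (Fin k) := Equiv.ofBijective σ hinj.bijective_of_finite
  refine ⟨orderOf τ, orderOf_pos τ, fun j x hx => ?_⟩
  have hτ : σ^[orderOf τ] j = j := by
    have h1 : (τ ^ orderOf τ) j = j := by rw [pow_orderOf_eq_one]; rfl
    rwa [← Equiv.Perm.iterate_eq_pow] at h1
  have := hiter (orderOf τ) j x hx
  rwa [hτ] at this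

lemma le_polEntropy_induced_of_apply_center [CompactSpace X] (c : StarChart X k b) (hk : 1 ≤ k)
    (f : X ≃ₜ X) (hb : f b = b) (hw : ∀ j, ∃ x ∈ range (c.e j), IsWandering f x) :
    (k : EReal) ≤ polEntropy (Subcontinua.induced f f.continuous) := by
  obtain ⟨N, hN, hedge⟩ := c.exists_iterate_preserves_edges f hb
  choose x hx hxw using hw
  have hbN : f^[N] b = b := Function.iterate_fixed hb N
  have hinj : Function.Injective f^[N] := f.injective.iterate N
  have hinv : ∀ z, f^[N] (f.symm^[N] z) = z :=
    Function.RightInverse.iterate (f := f) (g := f.symm) f.apply_symm_apply N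
  have hx0 : ∀ j, 0 < c.h j (x j) := by
    intro j
    obtain ⟨u, hu⟩ := hx j
    have hu0 : u ≠ 0 := by
      rintro rfl
      rw [c.e_zero] at hu
      exact (hxw j).iterate_ne le_rfl (by rw [← hu]; exact hb)
    rw [← hu, c.h_e]
    exact unitInterval.pos_iff_ne_zero.2 hu0
  have hp : ∀ j m, f^[N] ((f.symm^[N])^[m + 1] (x j)) = (f.symm^[N])^[m] (x j) := fun j m => by
    rw [Function.iterate_succ_apply', hinv]
  refine c.le_polEntropy_of_backward_orbits hk f.continuous hN hinj hbN hedge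
    (fun j m => (f.symm^[N])^[m] (x j)) hp (fun j m => ?_) fun j h => ?_
  · induction m with
    | zero => exact hx0 j
    | succ m ih =>
      -- Edges are only known to be preserved forwards: the preimage lies on some edge `i`, and
      -- mapping it forward gives `i = j`.
      obtain ⟨i, hi⟩ := c.exists_h_pos (x := (f.symm^[N])^[m + 1] (x j)) fun h => by
        refine c.ne_center_of_h_pos ih ?_
        rw [← hp, h, hbN]
      have h1 := hedge i _ hi
      rw [hp] at h1
      exact c.eq_of_h_pos h1 ih ▸ hi
  · have h1 : f^[N] (f.symm^[N] (x j)) = x j := hinv _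
    have h2 : f.symm^[N] (x j) = x j := h
    rw [h2] at h1
    exact (hxw j).iterate_ne hN h1

/-- A star with two edges is an arc. -/
lemma exists_homeomorph_unitInterval [CompactSpace X] (c : StarChart X 2 b) :
    Nonempty (X ≃ₜ unitInterval) := by
  -- The edges go to the two halves of the interval, and the centre to `1 / 2`.
  let q : X → unitInterval := fun x => ⟨(1 + c.h 0 x - c.h 1 x) / 2, by
    have h0 := (c.h 0 x).2
    have h1 := (c.h 1 x).2
    constructor <;> linarith [h0.1, h0.2, h1.1, h1.2]⟩
  have hq : Continuous q := by
    have := c.continuous_h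
    fun_prop
  have hq0 : ∀ u, (q (c.e 0 u) : ℝ) = (1 + u) / 2 := fun u => by
    simp only [q]
    rw [c.h_e, c.h_e_of_ne 1 0 (by decide)]
    simp
  have hq1 : ∀ u, (q (c.e 1 u) : ℝ) = (1 - u) / 2 := fun u => by
    simp only [q]
    rw [c.h_e, c.h_e_of_ne 0 1 (by decide)]
    simp
  have hinj : Function.Injective q := by
    have key : ∀ u v, q (c.e 0 u) = q (c.e 1 v) → c.e 0 u = c.e 1 v := by
      intro u v h
      have h' : (q (c.e 0 u) : ℝ) = q (c.e 1 v) := congrArg _ h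
      rw [hq0, hq1] at h'
      have hu : u = 0 := Subtype.ext (by push_cast; linarith [u.2.1, v.2.1])
      have hv : v = 0 := Subtype.ext (by push_cast; linarith [u.2.1, v.2.1])
      rw [hu, hv, c.e_zero, c.e_zero]
    intro x y hxy
    obtain ⟨i, u, rfl⟩ := c.exists_e x
    obtain ⟨j, v, rfl⟩ := c.exists_e y
    have h : (q (c.e i u) : ℝ) = q (c.e j v) := congrArg _ hxy
    match i, j with
    | 0, 0 => rw [hq0, hq0] at h; rw [Subtype.ext (by linarith : (u : ℝ) = v)]
    | 0, 1 => exact key u v hxy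
    | 1, 0 => exact (key v u hxy.symm).symm
    | 1, 1 => rw [hq1, hq1] at h; rw [Subtype.ext (by linarith : (u : ℝ) = v)]
  have hsurj : Function.Surjective q := by
    intro t
    have ht := t.2
    rcases le_total (t : ℝ) (1 / 2) with h | h
    · refine ⟨c.e 1 ⟨1 - 2 * t, by constructor <;> linarith [ht.1]⟩, Subtype.ext ?_⟩
      rw [hq1]
      ring
    · refine ⟨c.e 0 ⟨2 * t - 1, by constructor <;> linarith [ht.2]⟩, Subtype.ext ?_⟩
      rw [hq0]
      ring
  exact ⟨Continuous.homeoOfEquivCompactToT2 (f := Equiv.ofBijective q ⟨hinj, hsurj⟩) hq⟩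

end StarChart

/-- The subarc between two coordinates. -/
def Subcontinua.arc (ψ : X ≃ₜ unitInterval) (s t : unitInterval) (hst : s ≤ t) : Subcontinua X :=
  ⟨⟨⟨ψ.symm '' Icc s t, isCompact_Icc.image ψ.symm.continuous⟩, ⟨_, s, ⟨le_rfl, hst⟩, rfl⟩⟩,
    ⟨_, s, ⟨le_rfl, hst⟩, rfl⟩,
    ordConnected_Icc.isPreconnected.image _ ψ.symm.continuous.continuousOn⟩

lemma Subcontinua.mem_arc (ψ : X ≃ₜ unitInterval) {s t : unitInterval} (hst : s ≤ t) {x : X} :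
    x ∈ ((Subcontinua.arc ψ s t hst).1 : Set X) ↔ s ≤ ψ x ∧ ψ x ≤ t := by
  change x ∈ ψ.symm '' Icc s t ↔ _
  constructor
  · rintro ⟨u, hu, rfl⟩
    rwa [ψ.apply_symm_apply]
  · exact fun h => ⟨ψ x, h, ψ.symm_apply_apply x⟩

/-- The square of a homeomorphism of an arc is increasing even if the map reverses the arc, so the
backward orbit of `x` under `f^2` decreases. Its points serve as endpoints of the test arcs. -/
lemma two_le_polEntropy_of_lt [CompactSpace X] (ψ : X ≃ₜ unitInterval) (f : X ≃ₜ X) {x : X}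
    (hx : ψ x < ψ (f^[2] x)) :
    (2 : EReal) ≤ polEntropy (Subcontinua.induced f f.continuous) := by
  set g := f^[2] with hg
  let F : unitInterval → unitInterval := fun u => ψ (f (ψ.symm u))
  let G : unitInterval → unitInterval := fun u => ψ (g (ψ.symm u))
  have hGF : G = F ∘ F := by
    funext u
    simp [G, F, hg]
  have hF : StrictMono F ∨ StrictAnti F :=
    Continuous.strictMono_of_inj (by fun_prop)
      (ψ.injective.comp (f.injective.comp ψ.symm.injective))
  have hG : StrictMono G := by
    rw [hGF]
    exact hF.elim (fun h => h.comp h) fun h => h.comp h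
  have hgG : ∀ i z, ψ (g^[i] z) = G^[i] (ψ z) := fun i z =>
    (Function.Semiconj.iterate_right (f := ψ) (ga := g) (gb := G)
      (fun z => by simp [G]) i) z
  let p : ℕ → X := fun m => (f.symm^[2])^[m] x
  have hp : ∀ m, g (p (m + 1)) = p m := fun m => by
    simp only [p]
    rw [Function.iterate_succ_apply' (f.symm^[2])]
    exact Function.RightInverse.iterate (f := f) (g := f.symm) f.apply_symm_apply 2 _
  let y : ℕ → unitInterval := fun m => ψ (p m)
  have hy : ∀ m, G (y (m + 1)) = y m := fun m => by simp [G, y, hp]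
  have hy1 : y 1 < y 0 := by
    rw [← hG.lt_iff_lt, hy]
    simpa [G, y, p] using hx
  have hanti : StrictAnti y := hG.strictAnti_backward_orbit hy hy1
  obtain ⟨δ, hδ0, hδ⟩ := Subcontinua.exists_le_dist
    (CompactSpace.uniformContinuous_of_continuous ψ.continuous) (dist_pos.2 hy1.ne)
  -- The shift by `n` puts every left end below every right end.
  have hle : ∀ n (s : Fin 2 → Fin n), y (n + s 0) ≤ y (s 1) := fun n s =>
    hanti.antitone (by have := (s 1).2; omega)
  -- Left ends need up to `n + s 0 < 2 * n` steps of `f^2`, that is, fewer than `4 * n` steps of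
  -- `f`.
  refine le_polEntropy_of_separated (k := 2) f.continuous (T := 4) (by norm_num) hδ0
    (fun n s => Subcontinua.arc ψ _ _ (hle n s)) fun n => ?_
  have hfst : ∀ s t : Fin 2 → Fin n, s 1 < t 1 →
      δ ≤ dynDist (Subcontinua.induced f f.continuous) (4 * n) (Subcontinua.arc ψ _ _ (hle n s))
        (Subcontinua.arc ψ _ _ (hle n t)) := by
    intro s t hst
    refine Subcontinua.le_dynDist_induced f.continuous (N := 2) (i := s 1)
      (by have := (s 1).2; omega) fun K L hK hL => hδ K L ⟨p 0, ?_, fun w hw => ?_⟩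
    · rw [hK]
      exact ⟨p (s 1), (Subcontinua.mem_arc ψ _).2 ⟨hle n s, le_rfl⟩,
        iterate_backward_orbit_self hp _⟩
    · rw [hL] at hw
      obtain ⟨v, hv, rfl⟩ := hw
      obtain ⟨r, hr⟩ : ∃ r : ℕ, (t 1 : ℕ) = (r + 1) + s 1 :=
        ⟨t 1 - s 1 - 1, by have : (s 1 : ℕ) < t 1 := hst; omega⟩
      have h1 := hG.monotone.iterate (s 1) ((Subcontinua.mem_arc ψ _).1 hv).2
      rw [← hgG, hr, iterate_backward_orbit hy] at h1
      rw [dist_comm (ψ (p 0)) _]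
      exact unitInterval.dist_le_dist_of_le (h1.trans (hanti.antitone (by omega))) hy1.le le_rfl
  have hsnd : ∀ s t : Fin 2 → Fin n, s 0 < t 0 → s 1 = t 1 →
      δ ≤ dynDist (Subcontinua.induced f f.continuous) (4 * n) (Subcontinua.arc ψ _ _ (hle n s))
        (Subcontinua.arc ψ _ _ (hle n t)) := by
    intro s t hst hst1
    have hst' : (s 0 : ℕ) < t 0 := hst
    rw [dynDist_comm]
    refine Subcontinua.le_dynDist_induced f.continuous (N := 2) (i := n + s 0)
      (by have := (s 0).2; omega) fun L K hL hK => hδ L K ⟨p 1, ?_, fun w hw => ?_⟩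
    · rw [hL]
      -- This point, one step below the left end of the arc of `s`, still belongs to the arc of `t`,
      -- and reaches `p 1` when that left end reaches `p 0`.
      refine ⟨p (1 + (n + s 0)), (Subcontinua.mem_arc ψ _).2
        ⟨hanti.antitone (by omega), hanti.antitone ?_⟩, iterate_backward_orbit hp _ _⟩
      have := (t 1).2
      omega
    · rw [hK] at hw
      obtain ⟨v, hv, rfl⟩ := hw
      have h1 := hG.monotone.iterate (n + s 0) ((Subcontinua.mem_arc ψ _).1 hv).1
      rw [← hgG _ v, iterate_backward_orbit_self hy] at h1
      exact unitInterval.dist_le_dist_of_le le_rfl hy1.le h1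
  intro s t hst
  rcases lt_trichotomy (s 1) (t 1) with h | h | h
  · exact hfst s t h
  · rcases lt_trichotomy (s 0) (t 0) with h' | h' | h'
    · exact hsnd s t h' h
    · refine absurd (funext fun i => ?_) hst
      match i with
      | 0 => exact h'
      | 1 => exact h
    · rw [dynDist_comm]
      exact hsnd t s h' h.symm
  · rw [dynDist_comm]
    exact hfst t s h

/-- A homeomorphism of an arc whose square is not the identity induces a map of polynomial entropy
at least two. -/
lemma two_le_polEntropy_of_ne [CompactSpace X] (ψ : X ≃ₜ unitInterval) (f : X ≃ₜ X) {x : X}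
    (hx : f^[2] x ≠ x) : (2 : EReal) ≤ polEntropy (Subcontinua.induced f f.continuous) := by
  rcases lt_or_gt_of_ne (ψ.injective.ne hx) with h | h
  -- Reversing the coordinate makes `f^2` move `x` upwards.
  · exact two_le_polEntropy_of_lt (ψ.trans unitInterval.symmHomeomorph) f
      (unitInterval.symm_lt_symm.2 h)
  · exact two_le_polEntropy_of_lt ψ f h

end Cases

theorem theorem1p3 {X : Type*} [MetricSpace X] [CompactSpace X] (k : ℕ) (hk : 2 ≤ k)
    (b : X) (I : Fin k → Set X) (hX : IsStar k b I) (f : X ≃ₜ X)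
    (hw : ∀ j : Fin k, ∃ x ∈ I j, IsWandering f x) :
    polEntropy (Subcontinua.induced f f.continuous) = (k : EReal) := by
  obtain ⟨c, hc⟩ := hX.exists_chart
  refine le_antisymm (c.polEntropy_induced_le hk f) ?_
  simp only [hc] at hw
  rcases Nat.lt_or_ge k 3 with hk3 | hk3
  · obtain rfl : k = 2 := by omega
    obtain ⟨ψ⟩ := c.exists_homeomorph_unitInterval
    obtain ⟨x, -, hx⟩ := hw 0
    exact two_le_polEntropy_of_ne ψ f (hx.iterate_ne one_le_two)
  · exact c.le_polEntropy_induced_of_apply_center (by omega) f (c.apply_center hk3 f) hw
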